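/- Manifolds are smooth, finite-dimensional, Hausdorff, second countable (not required of Lie groups) and without boundary. Let $\mu:(A,\Omega)\to V$ be a symplectic principal $\mathbb R$-bundle: $\mu:A\to V$ is a principal $\mathbb R$-bundle with principal action $\psi:\mathbb R\times A\to A$, and $\Omega$ is a symplectic form on $A$ with $\psi_s^*\Omega=\Omega$ for all $s\in\mathbb R$. Let $Z_\mu$ be the infinitesimal generator of $\psi$. For $f\in C^\infty(A)$ let $\mathcal H_f$ be the vector field with $i_{\mathcal H_f}\Omega=df$, and put $\{f,f'\}_A=\Omega(\mathcal H_f,\mathcal H_{f'})=\mathcal H_{f'}(f)$. On a Poisson manifold, $\mathcal H_h$ is the vector field with $\mathcal H_h(f)=\{f,h\}$. Let $G$ be a Lie group with Lie algebra $\mathfrak g$, and let $\phi:G\times A\to A$ be a canonical action, i.e. a smooth left action such that $\phi_g^*\Omega=\Omega$ and $\phi_g\circ\psi_s=\psi_s\circ\phi_g$ for all $g\in G$, $s\in\mathbb R$, and $\Omega(Z_\mu,\xi_A)=0$ for all $\xi\in\mathfrak g$, where $\xi_A$ is the infinitesimal generator of $\phi$ defined by $\xi$. Let $J:A\to\mathfrak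 g^*$ be a momentum map for $\phi$, i.e. a smooth map with $\xi_A=\mathcal H_{J_\xi}$ for all $\xi\in\mathfrak g$, where $J_\xi(a)=\langle J(a),\xi\rangle$. Then there are a unique Poisson structure $\{\cdot,\cdot\}_V$ on $V$ with $\{f\circ\mu,f'\circ\mu\}_A=\{f,f'\}_V\circ\mu$ for all $f,f'\in C^\infty(V)$, a unique smooth action $\phi^V:G\times V\to V$ with $\phi^V_g\circ\mu=\mu\circ\phi_g$ for all $g\in G$, and a unique smooth map $J^V:V\to\mathfrak g^*$ with $J^V\circ\mu=J$. Moreover: i) $\phi^V$ is a Poisson action, i.e. every $\phi^V_g$ is a Poisson map for $\{\cdot,\cdot\}_V$; ii) $J^V$ is a momentum map for $\phi^V$, i.e. $\xi_V=\mathcal H_{J^V_\xi}$ for all $\xi\in\mathfrak g$, and if $J$ is $\mathrm{Ad}^*$-equivariant, i.e. $J(\phi_g(a))=\mathrm{Ad}^*_{g^{-1}}(J(a))$ for all $g\in G$ and $a\in A$, where $\langle\mathrm{Ad}^*_{g^{-1}}\nu,\xi\rangle=\langle\nu,\mathrm{Ad}_{g^{-1}}\xi\rangle$, then $J^V$ is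 $\mathrm{Ad}^*$-equivariant, i.e. $J^V(\phi^V_g(v))=\mathrm{Ad}^*_{g^{-1}}(J^V(v))$ for all $g\in G$ and $v\in V$. -/

import Mathlib

open scoped Manifold ContDiff

/-! ## Symplectic forms -/

section SymplecticForms

variable {E : Type*} [NormedAddCommGroup E] [NormedSpace ℝ E]
  {H : Type*} [TopologicalSpace H] (I : ModelWithCorners ℝ E H)
  (M : Type*) [TopologicalSpace M] [ChartedSpace H M]

/-- A vector field `X` on `M` is smooth if it is smooth as a map into the tangent bundle. -/
def IsSmoothVectorField [IsManifold I ∞ M] (X : ∀ x : M, TangentSpace I x) : Prop :=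
  ContMDiff I I.tangent ∞ (fun x => (⟨x, X x⟩ : TangentBundle I M))

variable {M} in
/-- The value at `x` of `(dσ)(X, Y, Z)`, for a two-form `σ` and vector fields `X`, `Y`, `Z`, given by
the coordinate-free formula
`X σ(Y,Z) - Y σ(X,Z) + Z σ(X,Y) - σ([X,Y],Z) + σ([X,Z],Y) - σ([Y,Z],X)`. -/
noncomputable def extDerivTwoForm (σ : ∀ x : M, TangentSpace I x →L[ℝ] TangentSpace I x →L[ℝ] ℝ)
    (X Y Z : ∀ x : M, TangentSpace I x) (x : M) : ℝ :=
  mvfderiv I (fun y => σ y (Y y) (Z y)) x (X x)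
    - mvfderiv I (fun y => σ y (X y) (Z y)) x (Y x)
    + mvfderiv I (fun y => σ y (X y) (Y y)) x (Z x)
    - σ x (VectorField.mlieBracket I X Y x) (Z x)
    + σ x (VectorField.mlieBracket I X Z x) (Y x)
    - σ x (VectorField.mlieBracket I Y Z x) (X x)

/-- A symplectic form: a smooth, closed, nondegenerate, alternating two-form. -/
structure SymplecticForm [IsManifold I ∞ M] where
  form : ∀ x : M, TangentSpace I x →L[ℝ] TangentSpace I x →L[ℝ] ℝ
  contMDiff_form : ContMDiff I (I.prod 𝓘(ℝ, E →L[ℝ] E →L[ℝ] ℝ)) ∞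
    (fun x : M => Bundle.TotalSpace.mk' (E →L[ℝ] E →L[ℝ] ℝ)
      (E := fun x : M => TangentSpace I x →L[ℝ] TangentSpace I x →L[ℝ] ℝ) x (form x))
  alternating : ∀ (x : M) (v : TangentSpace I x), form x v v = 0
  nondegenerate : ∀ (x : M) (v : TangentSpace I x), (∀ w, form x v w = 0) → v = 0
  closed : ∀ X Y Z : (∀ x : M, TangentSpace I x), IsSmoothVectorField I M X →
    IsSmoothVectorField I M Y → IsSmoothVectorField I M Z →
    ∀ x : M, extDerivTwoForm I form X Y Z x = 0

namespace SymplecticForm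

variable {I M} [IsManifold I ∞ M] (Ω : SymplecticForm I M)

theorem exists_sharp [FiniteDimensional ℝ E] (x : M) (α : TangentSpace I x →L[ℝ] ℝ) :
    ∃ v : TangentSpace I x, ∀ w, Ω.form x v w = α w := by
  have : FiniteDimensional ℝ (TangentSpace I x) := inferInstanceAs (FiniteDimensional ℝ E)
  let f : TangentSpace I x →ₗ[ℝ] Module.Dual ℝ (TangentSpace I x) :=
    { toFun := fun v => (Ω.form x v).toLinearMap
      map_add' := fun v w => by ext u; simp
      map_smul' := fun c v => by ext u; simp }
  have hf : Function.Injective f := by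
    rw [injective_iff_map_eq_zero]
    intro v hv
    exact Ω.nondegenerate x v (fun w => LinearMap.congr_fun hv w)
  have hs : Function.Surjective f :=
    (LinearMap.injective_iff_surjective_of_finrank_eq_finrank
      Subspace.dual_finrank_eq.symm).1 hf
  obtain ⟨v, hv⟩ := hs α.toLinearMap
  exact ⟨v, fun w => LinearMap.congr_fun hv w⟩

/-- The Hamiltonian vector field `H_f` of `f`, defined by `Ω(H_f, ·) = df`. -/
noncomputable def hamiltonian [FiniteDimensional ℝ E] (f : M → ℝ) (x : M) : TangentSpace I x :=
  (Ω.exists_sharp x (mvfderiv I f x)).choose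

theorem form_hamiltonian [FiniteDimensional ℝ E] (f : M → ℝ) (x : M) (w : TangentSpace I x) :
    Ω.form x (Ω.hamiltonian f x) w = mvfderiv I f x w :=
  (Ω.exists_sharp x (mvfderiv I f x)).choose_spec w

/-- The Poisson bracket `{f, g} = Ω(H_f, H_g) = H_g(f)` of the symplectic form `Ω`. -/
noncomputable def bracket [FiniteDimensional ℝ E] (f g : M → ℝ) (x : M) : ℝ :=
  Ω.form x (Ω.hamiltonian f x) (Ω.hamiltonian g x)

/-- `F^* Ω = Ω`. -/
def Preserves (F : M → M) : Prop :=
  ∀ (x : M) (v w : TangentSpace I x),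
    Ω.form (F x) (mfderiv I I F x v) (mfderiv I I F x w) = Ω.form x v w

end SymplecticForm

end SymplecticForms

/-! ## Poisson structures -/

section PoissonStructures

variable {E : Type*} [NormedAddCommGroup E] [NormedSpace ℝ E]
  {H : Type*} [TopologicalSpace H] (I : ModelWithCorners ℝ E H)
  (M : Type*) [TopologicalSpace M] [ChartedSpace H M]

/-- A Poisson structure on `M`: a Lie bracket on `C^∞(M)` which is a derivation in each entry. -/
structure PoissonStructure where
  bracket : C^∞⟮I, M; ℝ⟯ →ₗ[ℝ] C^∞⟮I, M; ℝ⟯ →ₗ[ℝ] C^∞⟮I, M; ℝ⟯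
  skew : ∀ f g, bracket f g = - bracket g f
  leibniz : ∀ f g h, bracket (f * g) h = f * bracket g h + g * bracket f h
  jacobi : ∀ f g h,
    bracket f (bracket g h) + bracket g (bracket h f) + bracket h (bracket f g) = 0

namespace PoissonStructure

variable {I M} (P : PoissonStructure I M)

/-- A smooth map `F : M → M` is a Poisson map if `{f ∘ F, g ∘ F} = {f, g} ∘ F`. -/
def IsPoissonMap (F : C^∞⟮I, M; I, M⟯) : Prop :=
  ∀ f g : C^∞⟮I, M; ℝ⟯, P.bracket (f.comp F) (g.comp F) = (P.bracket f g).comp F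

/-- `X` is the Hamiltonian vector field of `h`: `X(f) = {f, h}` for all smooth `f`. -/
def IsHamiltonianVectorField (h : C^∞⟮I, M; ℝ⟯) (X : ∀ x : M, TangentSpace I x) : Prop :=
  ∀ (f : C^∞⟮I, M; ℝ⟯) (x : M), mvfderiv I f x (X x) = P.bracket f h x

end PoissonStructure

end PoissonStructures

/-! ## Smooth actions of Lie groups, and the coadjoint action -/

section Actions

variable {EG : Type*} [NormedAddCommGroup EG] [NormedSpace ℝ EG]
  {HG : Type*} [TopologicalSpace HG] (IG : ModelWithCorners ℝ EG HG)
  (G : Type*) [TopologicalSpace G] [ChartedSpace HG G] [Group G]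

/-- The dual `𝔤^*` of the Lie algebra of `G`. The Lie algebra `GroupLieAlgebra IG G` is the tangent
space at `1`, whose underlying vector space is the model space `EG`; writing the dual through `EG`
gives it the structure of a normed space, hence of a manifold. -/
abbrev LieDual {EG : Type*} [NormedAddCommGroup EG] [NormedSpace ℝ EG]
    {HG : Type*} [TopologicalSpace HG] (_IG : ModelWithCorners ℝ EG HG)
    (G : Type*) [TopologicalSpace G] [ChartedSpace HG G] [Group G] : Type _ := EG →L[ℝ] ℝ

variable {G} in
/-- `Ad_g`, the differential at `1` of `h ↦ g h g⁻¹`. -/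
noncomputable def LieAd (g : G) (ξ : GroupLieAlgebra IG G) : GroupLieAlgebra IG G :=
  mfderiv IG IG (fun h : G => g * h * g⁻¹) 1 ξ

variable {E : Type*} [NormedAddCommGroup E] [NormedSpace ℝ E]
  {H : Type*} [TopologicalSpace H] (I : ModelWithCorners ℝ E H)
  (M : Type*) [TopologicalSpace M] [ChartedSpace H M]

/-- A smooth left action of `G` on `M`. -/
structure SmoothAction where
  act : G → M → M
  one_act : ∀ x, act 1 x = x
  mul_act : ∀ g h x, act (g * h) x = act g (act h x)
  contMDiff_act : ContMDiff (IG.prod I) I ∞ (fun p : G × M => act p.1 p.2)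

variable {IG G I M}

namespace SmoothAction

variable (φ : SmoothAction IG G I M)

/-- The smooth map `φ_g : M → M`. -/
def map (g : G) : C^∞⟮I, M; I, M⟯ :=
  ⟨φ.act g, φ.contMDiff_act.comp (contMDiff_const.prodMk contMDiff_id)⟩

/-- The infinitesimal generator `ξ_M` of `φ`: at `x`, the image of `ξ` under the differential at `1`
of `g ↦ φ_g(x)`. -/
noncomputable def generator (ξ : GroupLieAlgebra IG G) (x : M) : TangentSpace I x :=
  mfderiv IG I (fun g : G => φ.act g x) 1 ξ

end SmoothAction

/-- The function `J_ξ : M → ℝ`, `J_ξ(x) = ⟨J(x), ξ⟩`. -/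
noncomputable def momentComponent (J : C^∞⟮I, M; 𝓘(ℝ, LieDual IG G), LieDual IG G⟯)
    (ξ : GroupLieAlgebra IG G) : C^∞⟮I, M; ℝ⟯ :=
  ⟨fun x => J x ξ, J.contMDiff.clm_apply contMDiff_const⟩

/-- `J(φ_g(x)) = Ad^*_{g⁻¹}(J(x))`, where `⟨Ad^*_{g⁻¹} ν, ξ⟩ = ⟨ν, Ad_{g⁻¹} ξ⟩`. -/
def IsAdEquivariant (φ : SmoothAction IG G I M)
    (J : C^∞⟮I, M; 𝓘(ℝ, LieDual IG G), LieDual IG G⟯) : Prop :=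
  ∀ (g : G) (x : M) (ξ : GroupLieAlgebra IG G), J (φ.act g x) ξ = J x (LieAd IG g⁻¹ ξ)

/-- Every `φ_g` is a Poisson map. -/
def PoissonStructure.IsPoissonAction (P : PoissonStructure I M) (φ : SmoothAction IG G I M) :
    Prop :=
  ∀ g : G, P.IsPoissonMap (φ.map g)

/-- `J` is a momentum map: `ξ_M` is the Hamiltonian vector field of `J_ξ`, for all `ξ`. -/
def PoissonStructure.IsMomentumMap (P : PoissonStructure I M) (φ : SmoothAction IG G I M)
    (J : C^∞⟮I, M; 𝓘(ℝ, LieDual IG G), LieDual IG G⟯) : Prop :=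
  ∀ ξ : GroupLieAlgebra IG G, P.IsHamiltonianVectorField (momentComponent J ξ) (φ.generator ξ)

/-- `J` is a momentum map on a symplectic manifold: `ξ_M` is the Hamiltonian vector field of `J_ξ`,
for all `ξ`. -/
def SymplecticForm.IsMomentumMap [FiniteDimensional ℝ E] [IsManifold I ∞ M]
    (Ω : SymplecticForm I M) (φ : SmoothAction IG G I M)
    (J : C^∞⟮I, M; 𝓘(ℝ, LieDual IG G), LieDual IG G⟯) : Prop :=
  ∀ (ξ : GroupLieAlgebra IG G) (x : M),
    φ.generator ξ x = Ω.hamiltonian (momentComponent J ξ) x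

end Actions

/-! ## Symplectic principal `ℝ`-bundles -/

section Bundles

variable {EA : Type*} [NormedAddCommGroup EA] [NormedSpace ℝ EA]
  {HA : Type*} [TopologicalSpace HA] (IA : ModelWithCorners ℝ EA HA)
  (A : Type*) [TopologicalSpace A] [ChartedSpace HA A]
  {EV : Type*} [NormedAddCommGroup EV] [NormedSpace ℝ EV]
  {HV : Type*} [TopologicalSpace HV] (IV : ModelWithCorners ℝ EV HV)
  (V : Type*) [TopologicalSpace V] [ChartedSpace HV V]

/-- A principal `ℝ`-bundle `μ : A → V`: a smooth action `ψ` of `(ℝ, +)` on `A` and a smooth map `μ`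
which is locally trivial, by smooth trivializations `μ⁻¹(U) ≃ U × ℝ` that intertwine `ψ_s` with the
translation by `s` on the fibre `ℝ`. -/
structure PrincipalRBundle where
  proj : A → V
  flow : ℝ → A → A
  contMDiff_proj : ContMDiff IA IV ∞ proj
  flow_zero : ∀ a, flow 0 a = a
  flow_add : ∀ s t a, flow (s + t) a = flow s (flow t a)
  contMDiff_flow : ContMDiff (𝓘(ℝ, ℝ).prod IA) IA ∞ (fun p : ℝ × A => flow p.1 p.2)
  proj_flow : ∀ s a, proj (flow s a) = proj a
  locally_trivial : ∀ v : V, ∃ e : Bundle.Trivialization ℝ proj, v ∈ e.baseSet ∧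
    ContMDiffOn IA (IV.prod 𝓘(ℝ, ℝ)) ∞ e e.source ∧
    ContMDiffOn (IV.prod 𝓘(ℝ, ℝ)) IA ∞ e.toOpenPartialHomeomorph.symm e.target ∧
    ∀ a ∈ e.source, ∀ s : ℝ, (e (flow s a)).2 = s + (e a).2

/-- A symplectic principal `ℝ`-bundle: a symplectic form on the total space for which the principal
action is symplectic. -/
structure SymplecticPrincipalRBundle [IsManifold IA ∞ A] extends PrincipalRBundle IA A IV V where
  Ω : SymplecticForm IA A
  flow_symplectic : ∀ s : ℝ, Ω.Preserves (flow s)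

variable {IA A IV V}

/-- The infinitesimal generator `Z_μ` of the principal action. -/
noncomputable def PrincipalRBundle.generator (B : PrincipalRBundle IA A IV V) (a : A) :
    TangentSpace IA a :=
  mfderiv 𝓘(ℝ, ℝ) IA (fun s : ℝ => B.flow s a) 0 (1 : ℝ)

namespace SymplecticPrincipalRBundle

variable [IsManifold IA ∞ A] (B : SymplecticPrincipalRBundle IA A IV V)

/-- A Poisson structure on the base for which `μ` is a Poisson map:
`{f ∘ μ, g ∘ μ}_A = {f, g}_V ∘ μ`. -/
def ProjIsPoisson [FiniteDimensional ℝ EA] (P : PoissonStructure IV V) : Prop :=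
  ∀ (f g : C^∞⟮IV, V; ℝ⟯) (a : A),
    B.Ω.bracket (fun b => f (B.proj b)) (fun b => g (B.proj b)) a = P.bracket f g (B.proj a)

variable {EG : Type*} [NormedAddCommGroup EG] [NormedSpace ℝ EG]
  {HG : Type*} [TopologicalSpace HG] {IG : ModelWithCorners ℝ EG HG}
  {G : Type*} [TopologicalSpace G] [ChartedSpace HG G] [Group G]

/-- A canonical action on a symplectic principal `ℝ`-bundle: it is symplectic, commutes with the
principal action, and the one-form `Ω(Z_μ, ·)` vanishes on its infinitesimal generators. -/
structure IsCanonicalAction (φ : SmoothAction IG G IA A) : Prop where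
  symplectic : ∀ g : G, B.Ω.Preserves (φ.act g)
  commute : ∀ (g : G) (s : ℝ) (a : A), φ.act g (B.flow s a) = B.flow s (φ.act g a)
  basic : ∀ (ξ : GroupLieAlgebra IG G) (a : A),
    B.Ω.form a (B.toPrincipalRBundle.generator a) (φ.generator ξ a) = 0

end SymplecticPrincipalRBundle

end Bundles

section VectorFields

open Set Filter VectorField
open scoped Topology

variable {E : Type*} [NormedAddCommGroup E] [NormedSpace ℝ E]
  {H : Type*} [TopologicalSpace H] {I : ModelWithCorners ℝ E H}
  {M : Type*} [TopologicalSpace M] [ChartedSpace H M]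

theorem ContMDiffAt.mvfderiv_apply [IsManifold I ∞ M] {f : M → ℝ} (hf : ContMDiff I 𝓘(ℝ, ℝ) ∞ f)
    {X : ∀ x : M, TangentSpace I x} {x : M}
    (hX : ContMDiffAt I I.tangent ∞ (fun y => (⟨y, X y⟩ : TangentBundle I M)) x) :
    ContMDiffAt I 𝓘(ℝ, ℝ) ∞ (fun y => mvfderiv I f y (X y)) x := by
  have h1 : ContMDiff I.tangent 𝓘(ℝ, ℝ).tangent ∞ (tangentMap I 𝓘(ℝ, ℝ) f) :=
    hf.contMDiff_tangentMap (by simp)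
  exact (contMDiff_snd_tangentBundle_modelSpace ℝ 𝓘(ℝ, ℝ)).contMDiffAt.comp x
    (h1.contMDiffAt.comp x hX)

/-- The derivative along `[X, Y]` is the commutator of the derivatives along `X` and `Y`. -/
theorem mvfderiv_mlieBracket [CompleteSpace E] [IsManifold I ∞ M] [I.Boundaryless] {f : M → ℝ}
    (hf : ContMDiff I 𝓘(ℝ, ℝ) ∞ f) {X Y : ∀ x : M, TangentSpace I x}
    (hX : IsSmoothVectorField I M X) (hY : IsSmoothVectorField I M Y) (x : M) :
    mvfderiv I f x (mlieBracket I X Y x) =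
      mvfderiv I (fun y => mvfderiv I f y (Y y)) x (X x) -
        mvfderiv I (fun y => mvfderiv I f y (X y)) x (Y x) := by
  set φ := extChartAt I x
  have hr : range I = univ := I.range_eq_univ
  let p : (∀ x : M, TangentSpace I x) → E → E := fun Z =>
    mpullbackWithin 𝓘(ℝ, E) I φ.symm Z (range I)
  have hpull : ∀ {h : M → ℝ} (_ : MDifferentiable I 𝓘(ℝ, ℝ) h) (Z : ∀ x : M, TangentSpace I x)
      {y : E} (_ : y ∈ φ.target),
      fderiv ℝ (h ∘ φ.symm) y (p Z y) = mvfderiv I h (φ.symm y) (Z (φ.symm y)) := by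
    intro h hh Z y hy
    have hi := isInvertible_mfderivWithin_extChartAt_symm (I := I) hy
    have hs : MDifferentiableAt 𝓘(ℝ, E) I φ.symm y := by
      have := mdifferentiableWithinAt_extChartAt_symm (I := I) hy
      rwa [hr, mdifferentiableWithinAt_univ] at this
    rw [← mfderiv_eq_fderiv]
    have := mvfderiv_comp_apply (g := h) (f := φ.symm) y (hh _) hs (p Z y)
    refine this.trans ?_
    congr 1
    simp only [p, mpullbackWithin_apply]
    rw [hr, mfderivWithin_univ] at hi ⊢
    exact hi.self_apply_inverse _
  have hxt : φ x ∈ φ.target := mem_extChartAt_target x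
  have hxx : φ.symm (φ x) = x := extChartAt_to_inv x
  have hpull0 : ∀ {h : M → ℝ} (_ : MDifferentiable I 𝓘(ℝ, ℝ) h) (Z : ∀ x : M, TangentSpace I x),
      fderiv ℝ (h ∘ φ.symm) (φ x) (p Z (φ x)) = mvfderiv I h x (Z x) := by
    intro h hh Z
    rw [hpull hh Z hxt, hxx]
  have htn : φ.target ∈ 𝓝 (φ x) := extChartAt_target_mem_nhds x
  have hf' : ContDiffAt ℝ ∞ (f ∘ φ.symm) (φ x) := by
    have h1 : ContMDiffOn 𝓘(ℝ, E) 𝓘(ℝ, ℝ) ∞ (f ∘ φ.symm) φ.target :=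
      hf.comp_contMDiffOn (contMDiffOn_extChartAt_symm x)
    exact (h1.contMDiffAt htn).contDiffAt
  have hp : ∀ Z : (∀ x : M, TangentSpace I x), IsSmoothVectorField I M Z →
      DifferentiableAt ℝ (p Z) (φ x) := by
    intro Z hZ
    have h1 := contMDiffWithinAt_mpullbackWithin_extChartAt_symm (I := I) (m := 1) (n := ∞)
      (V := Z) (s := univ) (x := x) ((hZ x).of_le (by simp)).contMDiffWithinAt
      uniqueMDiffOn_univ (mem_univ x) (one_add_one_eq_two.trans_le ENat.LEInfty.out)
    have h2 : ContMDiffAt 𝓘(ℝ, E) 𝓘(ℝ, E).tangent 1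
      (fun y => (⟨y, p Z y⟩ : TangentBundle 𝓘(ℝ, E) E)) (φ x) :=
        h1.contMDiffAt (by rwa [preimage_univ, inter_univ])
    have h3 := (contMDiff_snd_tangentBundle_modelSpace E 𝓘(ℝ, E) (n := 1)).contMDiffAt.comp _ h2
    exact h3.contDiffAt.differentiableAt one_ne_zero
  have hsm : ∀ Z : (∀ x : M, TangentSpace I x), IsSmoothVectorField I M Z →
      MDifferentiable I 𝓘(ℝ, ℝ) (fun y => mvfderiv I f y (Z y)) := fun Z hZ y =>
    (ContMDiffAt.mvfderiv_apply hf (hZ y)).mdifferentiableAt (by simp)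
  have hfd : MDifferentiable I 𝓘(ℝ, ℝ) f := hf.mdifferentiable (by simp)
  have hiter : ∀ Z W : (∀ x : M, TangentSpace I x), IsSmoothVectorField I M Z →
      fderiv ℝ (fun y => fderiv ℝ (f ∘ φ.symm) y (p Z y)) (φ x) (p W (φ x)) =
        mvfderiv I (fun y => mvfderiv I f y (Z y)) x (W x) := by
    intro Z W hZ
    rw [← hpull0 (hsm Z hZ) W]
    congr 1
    apply Filter.EventuallyEq.fderiv_eq
    filter_upwards [htn] with y hy using hpull hfd Z hy
  rw [← hiter Y X hY, ← hiter X Y hX, ← fderiv_apply_lieBracket hf'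
    (by simpa using ENat.LEInfty.out) (hp Y hY) (hp X hX)]
  have hfφ : f =ᶠ[𝓝 x] (f ∘ φ.symm) ∘ φ := by
    filter_upwards [extChartAt_source_mem_nhds (I := I) x] with y hy
    exact congrArg f ((extChartAt I x).left_inv hy).symm
  have hD := isInvertible_mfderiv_extChartAt (I := I) (mem_extChartAt_source (I := I) x)
  have h1 : mvfderiv I f x = mvfderiv I ((f ∘ φ.symm) ∘ φ) x := by
    unfold mvfderiv
    rw [hfφ.mfderiv_eq]
    rfl
  rw [h1, mvfderiv_comp_apply x (hf'.contMDiffAt.mdifferentiableAt (by simp))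
    (mdifferentiableAt_extChartAt (mem_chart_source H x)), ← lieBracketWithin_univ]
  have h2 : mfderiv I 𝓘(ℝ, E) φ x (mlieBracket I X Y x) =
      lieBracketWithin ℝ (p X) (p Y) univ (φ x) := by
    rw [← mlieBracketWithin_univ, mlieBracketWithin_apply, preimage_univ, univ_inter]
    refine (hD.self_apply_inverse _).trans ?_
    simp only [p, hr]
    rfl
  rw [h2, ← mfderiv_eq_fderiv]
  rfl


theorem ContMDiffAt.matrix_det {ι : Type*} [Fintype ι] [DecidableEq ι]
    {A : M → Matrix ι ι ℝ} {x : M} (hA : ∀ i j, ContMDiffAt I 𝓘(ℝ, ℝ) ∞ (fun y => A y i j) x) :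
    ContMDiffAt I 𝓘(ℝ, ℝ) ∞ (fun y => (A y).det) x := by
  simp only [Matrix.det_apply]
  refine ContMDiffAt.sum fun σ _ => ?_
  simp only [Units.smul_def, zsmul_eq_mul]
  refine contMDiffAt_const.mul ?_
  exact contMDiffAt_finsetProd fun i _ => hA _ _

end VectorFields

namespace SymplecticForm

variable {E : Type*} [NormedAddCommGroup E] [NormedSpace ℝ E]
  {H : Type*} [TopologicalSpace H] {I : ModelWithCorners ℝ E H}
  {M : Type*} [TopologicalSpace M] [ChartedSpace H M] [IsManifold I ∞ M] (Ω : SymplecticForm I M)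

theorem form_swap (x : M) (v w : TangentSpace I x) : Ω.form x v w = -Ω.form x w v := by
  have h := Ω.alternating x (v + w)
  simp only [map_add, add_apply, Ω.alternating] at h
  linarith

theorem contMDiffAt_form_apply {X Y : ∀ x : M, TangentSpace I x} {x : M}
    (hX : ContMDiffAt I I.tangent ∞ (fun y => (⟨y, X y⟩ : TangentBundle I M)) x)
    (hY : ContMDiffAt I I.tangent ∞ (fun y => (⟨y, Y y⟩ : TangentBundle I M)) x) :
    ContMDiffAt I 𝓘(ℝ, ℝ) ∞ (fun y => Ω.form y (X y) (Y y)) x := by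
  have h := ContMDiffAt.clm_bundle_apply₂ (E₃ := fun _ : M => ℝ) (F₃ := ℝ) (b := id)
    (Ω.contMDiff_form x) hX hY
  rw [Bundle.contMDiffAt_totalSpace] at h
  exact h.2

variable [FiniteDimensional ℝ E]

theorem isSmoothVectorField_hamiltonian {f : M → ℝ} (hf : ContMDiff I 𝓘(ℝ, ℝ) ∞ f) :
    IsSmoothVectorField I M (Ω.hamiltonian f) := by
  intro x
  classical
  let e := trivializationAt E (TangentSpace I : M → Type _) x
  have hx : x ∈ e.baseSet := FiberBundle.mem_baseSet_trivializationAt' x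
  let b := Module.finBasis ℝ E
  let s := e.localFrame b
  have hs : ∀ i, ContMDiffAt I I.tangent ∞ (fun y => (⟨y, s i y⟩ : TangentBundle I M)) x :=
    fun i => contMDiffAt_localFrame_of_mem (I := I) ∞ e b i hx
  let A : M → Matrix _ _ ℝ := fun y => Matrix.of fun j i => Ω.form y (s i y) (s j y)
  let d : M → _ → ℝ := fun y j => mvfderiv I f y (s j y)
  let c : M → _ → ℝ := fun y i => e.localFrameCoeff I b i y (Ω.hamiltonian f y)
  have hexp : ∀ y ∈ e.baseSet, ∀ v : TangentSpace I y,
      v = ∑ i, e.localFrameCoeff I b i y v • s i y := by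
    intro y hy v
    simpa using e.eq_sum_localFrameCoeff_smul (I := I) (b := b)
        (s := fun z => if h : z = y then h ▸ v else 0) hy
  refine (_root_.contMDiffAt_iff_localFrameCoeff b hx).2 fun i => ?_
  have hA : ∀ i j, ContMDiffAt I 𝓘(ℝ, ℝ) ∞ (fun y => A y i j) x := fun i j =>
    Ω.contMDiffAt_form_apply (hs j) (hs i)
  have hd : ∀ j, ContMDiffAt I 𝓘(ℝ, ℝ) ∞ (fun y => d y j) x := fun j => ContMDiffAt.mvfderiv_apply hf (hs j)
  have hAd : ∀ y ∈ e.baseSet, (A y).mulVec (c y) = d y := by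
    intro y hy
    ext j
    have h := Ω.form_hamiltonian f y (s j y)
    rw [hexp y hy (Ω.hamiltonian f y)] at h
    simpa [Matrix.mulVec, dotProduct, A, c, mul_comm] using h
  have hdet : ∀ y ∈ e.baseSet, (A y).det ≠ 0 := by
    intro y hy h0
    obtain ⟨v, hv, hv0⟩ := Matrix.exists_mulVec_eq_zero_iff.2 h0
    refine hv (funext fun i => ?_)
    have hw : ∑ i, v i • s i y = 0 := by
      refine Ω.nondegenerate y _ fun w => ?_
      rw [hexp y hy w]
      have : ∀ j, Ω.form y (∑ i, v i • s i y) (s j y) = 0 := fun j => by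
        simpa [Matrix.mulVec, dotProduct, A, mul_comm] using congrFun hv0 j
      rw [map_sum]
      refine Finset.sum_eq_zero fun j _ => ?_
      rw [map_smul, this, smul_zero]
    have hli := (e.isLocalFrameOn_localFrame_baseSet I ∞ b).linearIndependent hy
    exact Fintype.linearIndependent_iff.1 hli v hw i
  have hc : ∀ y ∈ e.baseSet, c y i = ((A y).updateCol i (d y)).det * ((A y).det)⁻¹ := by
    intro y hy
    rw [eq_mul_inv_iff_mul_eq₀ (hdet y hy), ← Matrix.cramer_apply, ← hAd y hy,
      Matrix.cramer_eq_adjugate_mulVec, Matrix.mulVec_mulVec, Matrix.adjugate_mul]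
    simp [mul_comm, Matrix.smul_mulVec]
  refine ContMDiffAt.congr_of_eventuallyEq (f := fun y =>
    ((A y).updateCol i (d y)).det * ((A y).det)⁻¹) ?_ ?_
  · refine ContMDiffAt.mul (ContMDiffAt.matrix_det fun j k => ?_)
      ((ContMDiffAt.matrix_det hA).inv₀ (hdet x hx))
    by_cases h : k = i
    · subst h; simpa using hd j
    · simpa [h] using hA j k
  · filter_upwards [e.open_baseSet.mem_nhds hx] with y hy using hc y hy


theorem mvfderiv_hamiltonian (f g : M → ℝ) (x : M) :
    mvfderiv I f x (Ω.hamiltonian g x) = Ω.bracket f g x :=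
  (Ω.form_hamiltonian f x _).symm

theorem bracket_swap (f g : M → ℝ) (x : M) : Ω.bracket f g x = -Ω.bracket g f x :=
  Ω.form_swap x _ _

theorem contMDiff_bracket {f g : M → ℝ} (hf : ContMDiff I 𝓘(ℝ, ℝ) ∞ f)
    (hg : ContMDiff I 𝓘(ℝ, ℝ) ∞ g) : ContMDiff I 𝓘(ℝ, ℝ) ∞ (Ω.bracket f g) := fun x =>
  Ω.contMDiffAt_form_apply (Ω.isSmoothVectorField_hamiltonian hf x)
    (Ω.isSmoothVectorField_hamiltonian hg x)

theorem bracket_add_left {f g h : M → ℝ} {x : M} (hf : MDifferentiableAt I 𝓘(ℝ, ℝ) f x)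
    (hg : MDifferentiableAt I 𝓘(ℝ, ℝ) g x) :
    Ω.bracket (fun y => f y + g y) h x = Ω.bracket f h x + Ω.bracket g h x := by
  simp only [← mvfderiv_hamiltonian]
  exact DFunLike.congr_fun (mvfderiv_add hf hg) _

theorem bracket_mul_left {f g h : M → ℝ} {x : M} (hf : MDifferentiableAt I 𝓘(ℝ, ℝ) f x)
    (hg : MDifferentiableAt I 𝓘(ℝ, ℝ) g x) :
    Ω.bracket (fun y => f y * g y) h x = f x * Ω.bracket g h x + g x * Ω.bracket f h x := by
  simp only [← mvfderiv_hamiltonian]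
  refine (DFunLike.congr_fun (mvfderiv_mul hf hg) _).trans ?_
  simp

theorem bracket_const_mul_left {f h : M → ℝ} {x : M} (hf : MDifferentiableAt I 𝓘(ℝ, ℝ) f x)
    (c : ℝ) : Ω.bracket (fun y => c * f y) h x = c * Ω.bracket f h x := by
  rw [Ω.bracket_mul_left mdifferentiableAt_const hf, ← Ω.mvfderiv_hamiltonian (fun _ => c),
    mvfderiv_const]
  simp

/-- The Jacobi identity for the bracket of a symplectic form, a consequence of `dΩ = 0`. -/
theorem bracket_jacobi [I.Boundaryless] {f g h : M → ℝ} (hf : ContMDiff I 𝓘(ℝ, ℝ) ∞ f)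
    (hg : ContMDiff I 𝓘(ℝ, ℝ) ∞ g) (hh : ContMDiff I 𝓘(ℝ, ℝ) ∞ h) (x : M) :
    Ω.bracket f (Ω.bracket g h) x + Ω.bracket g (Ω.bracket h f) x
      + Ω.bracket h (Ω.bracket f g) x = 0 := by
  have : CompleteSpace E := FiniteDimensional.complete ℝ E
  have sf := Ω.isSmoothVectorField_hamiltonian hf
  have sg := Ω.isSmoothVectorField_hamiltonian hg
  have sh := Ω.isSmoothVectorField_hamiltonian hh
  have hlie : ∀ {a b c : M → ℝ}, ContMDiff I 𝓘(ℝ, ℝ) ∞ a → ContMDiff I 𝓘(ℝ, ℝ) ∞ b →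
      ContMDiff I 𝓘(ℝ, ℝ) ∞ c →
      Ω.form x (VectorField.mlieBracket I (Ω.hamiltonian a) (Ω.hamiltonian b) x)
        (Ω.hamiltonian c x) = Ω.bracket (Ω.bracket c a) b x - Ω.bracket (Ω.bracket c b) a x := by
    intro a b c ha hb hc
    rw [form_swap, form_hamiltonian, mvfderiv_mlieBracket hc (Ω.isSmoothVectorField_hamiltonian ha)
      (Ω.isSmoothVectorField_hamiltonian hb)]
    simp only [mvfderiv_hamiltonian]
    ring
  have hneg : ∀ {a b c : M → ℝ}, Ω.bracket (Ω.bracket a b) c x = -Ω.bracket (Ω.bracket b a) c x := by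
    intro a b c
    have : Ω.bracket a b = -Ω.bracket b a := funext fun y => Ω.bracket_swap a b y
    rw [this, ← mvfderiv_hamiltonian, mvfderiv_neg, ← mvfderiv_hamiltonian]
    rfl
  have hd : ∀ a b c : M → ℝ,
      mvfderiv I (fun y => Ω.form y (Ω.hamiltonian a y) (Ω.hamiltonian b y)) x
        (Ω.hamiltonian c x) = Ω.bracket (Ω.bracket a b) c x :=
    fun a b c => Ω.mvfderiv_hamiltonian (Ω.bracket a b) c x
  have key := Ω.closed _ _ _ sf sg sh x
  rw [extDerivTwoForm, hd, hd, hd, hlie hf hg hh, hlie hf hh hg, hlie hg hh hf,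
    @hneg h g f, @hneg h f g, @hneg g f h] at key
  rw [Ω.bracket_swap f, Ω.bracket_swap g, Ω.bracket_swap h, @hneg h f g]
  generalize Ω.bracket (Ω.bracket g h) f x = u at *
  generalize Ω.bracket (Ω.bracket f h) g x = v at *
  generalize Ω.bracket (Ω.bracket f g) h x = w at *
  clear * - key
  linarith

theorem bracket_comp {F F' : M → M} (hF : ContMDiff I I ∞ F) (hF' : ContMDiff I I ∞ F')
    (hFF' : ∀ x, F (F' x) = x) (hΩ : Ω.Preserves F) {f g : M → ℝ}
    (hf : ContMDiff I 𝓘(ℝ, ℝ) ∞ f) (hg : ContMDiff I 𝓘(ℝ, ℝ) ∞ g) (x : M)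
    (hx : F' (F x) = x) :
    Ω.bracket (fun y => f (F y)) (fun y => g (F y)) x = Ω.bracket f g (F x) := by
  have hFd : MDifferentiableAt I I F x := hF.mdifferentiable (by simp) x
  have hsurj : ∀ w : TangentSpace I (F x), ∃ v : TangentSpace I x, mfderiv I I F x v = w := by
    intro w
    have h2 := mfderiv_comp_apply_of_eq (I := I) (I' := I) (I'' := I) (g := F) (f := F') (x := F x)
      (y := x) hFd (hF'.mdifferentiable (by simp) _) hx w
    have h3 : F ∘ F' = id := funext hFF'
    rw [h3, mfderiv_id] at h2
    rw [hx] at h2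
    exact ⟨_, h2.symm⟩
  have hH : ∀ {k : M → ℝ}, ContMDiff I 𝓘(ℝ, ℝ) ∞ k →
      mfderiv I I F x (Ω.hamiltonian (fun y => k (F y)) x) = Ω.hamiltonian k (F x) := by
    intro k hk
    refine sub_eq_zero.1 (Ω.nondegenerate _ _ fun w => ?_)
    obtain ⟨v, rfl⟩ := hsurj w
    rw [map_sub, sub_apply, hΩ, form_hamiltonian, form_hamiltonian, sub_eq_zero]
    exact mvfderiv_comp_apply x (hk.mdifferentiable (by simp) _) hFd v
  unfold bracket
  rw [← hH hf, ← hH hg, hΩ]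

end SymplecticForm

namespace PrincipalRBundle

open scoped Topology

variable {EA : Type*} [NormedAddCommGroup EA] [NormedSpace ℝ EA]
  {HA : Type*} [TopologicalSpace HA] {IA : ModelWithCorners ℝ EA HA}
  {A : Type*} [TopologicalSpace A] [ChartedSpace HA A]
  {EV : Type*} [NormedAddCommGroup EV] [NormedSpace ℝ EV]
  {HV : Type*} [TopologicalSpace HV] {IV : ModelWithCorners ℝ EV HV}
  {V : Type*} [TopologicalSpace V] [ChartedSpace HV V]
  (B : PrincipalRBundle IA A IV V)

theorem exists_section (v : V) : ∃ σ : V → A, ContMDiffAt IV IA ∞ σ v ∧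
    ∀ᶠ w in 𝓝 v, B.proj (σ w) = w := by
  obtain ⟨e, hv, -, he, -⟩ := B.locally_trivial v
  have hmem : ∀ w ∈ e.baseSet, (w, (0 : ℝ)) ∈ e.target := fun w hw => e.mem_target.2 hw
  refine ⟨fun w => e.toOpenPartialHomeomorph.symm (w, 0), ?_, ?_⟩
  · exact (he.contMDiffAt (e.open_target.mem_nhds (hmem v hv))).comp v
      (contMDiff_id.prodMk contMDiff_const).contMDiffAt
  · filter_upwards [e.open_baseSet.mem_nhds hv] with w hw using e.proj_symm_apply (hmem w hw)

theorem proj_surjective : Function.Surjective B.proj := fun v =>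
  let ⟨σ, _, hσ⟩ := B.exists_section v
  ⟨σ v, hσ.self_of_nhds⟩

theorem exists_flow_eq {a b : A} (h : B.proj a = B.proj b) : ∃ s, B.flow s a = b := by
  obtain ⟨e, hv, -, -, he⟩ := B.locally_trivial (B.proj b)
  have hb : b ∈ e.source := e.mem_source.2 hv
  have ha : a ∈ e.source := e.mem_source.2 (h ▸ hv)
  have hab : B.flow ((e b).2 - (e a).2) a ∈ e.source := e.mem_source.2 (by rwa [B.proj_flow, h])
  have key : e (B.flow ((e b).2 - (e a).2) a) = e b := by
    refine Prod.ext ?_ ?_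
    · rw [e.coe_fst hb, e.coe_fst hab, B.proj_flow, h]
    · rw [he a ha, sub_add_cancel]
  exact ⟨_, e.injOn hab hb key⟩

theorem eq_of_proj_eq {α : Type*} {f : A → α} (hf : ∀ s a, f (B.flow s a) = f a) {a b : A}
    (h : B.proj a = B.proj b) : f a = f b := by
  obtain ⟨s, rfl⟩ := B.exists_flow_eq h
  exact (hf s a).symm

/-- The function on the base induced by a flow-invariant function on the total space. -/
noncomputable def descend {α : Type*} (f : A → α) (v : V) : α :=
  f (Function.surjInv B.proj_surjective v)

theorem descend_proj {α : Type*} {f : A → α} (hf : ∀ s a, f (B.flow s a) = f a) (a : A) :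
    B.descend f (B.proj a) = f a :=
  B.eq_of_proj_eq hf (Function.surjInv_eq B.proj_surjective _)

variable {E' : Type*} [NormedAddCommGroup E'] [NormedSpace ℝ E']
  {H' : Type*} [TopologicalSpace H'] {I' : ModelWithCorners ℝ E' H'}
  {N : Type*} [TopologicalSpace N] [ChartedSpace H' N]

theorem contMDiff_of_comp_proj {f : V → N} (hf : ContMDiff IA I' ∞ fun a => f (B.proj a)) :
    ContMDiff IV I' ∞ f := by
  intro v
  obtain ⟨σ, hσ, hs⟩ := B.exists_section v
  refine (hf.contMDiffAt.comp v hσ).congr_of_eventuallyEq ?_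
  filter_upwards [hs] with w hw
  simp [hw]

theorem contMDiff_of_comp_proj_snd {E'' : Type*} [NormedAddCommGroup E''] [NormedSpace ℝ E'']
    {H'' : Type*} [TopologicalSpace H''] {I'' : ModelWithCorners ℝ E'' H''}
    {K : Type*} [TopologicalSpace K] [ChartedSpace H'' K] {f : K × V → N}
    (hf : ContMDiff (I''.prod IA) I' ∞ fun p : K × A => f (p.1, B.proj p.2)) :
    ContMDiff (I''.prod IV) I' ∞ f := by
  rintro ⟨k, v⟩
  obtain ⟨σ, hσ, hs⟩ := B.exists_section v
  have h1 : ContMDiffAt (I''.prod IV) (I''.prod IA) ∞ (fun p : K × V => (p.1, σ p.2)) (k, v) :=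
    contMDiffAt_fst.prodMk (ContMDiffAt.comp (k, v) (g := σ) hσ contMDiffAt_snd)
  refine (hf.contMDiffAt.comp (k, v) h1).congr_of_eventuallyEq ?_
  filter_upwards [continuousAt_snd.eventually hs] with p hp
  simp [hp]

theorem contMDiff_flow_left (a : A) : ContMDiff 𝓘(ℝ, ℝ) IA ∞ fun s => B.flow s a :=
  B.contMDiff_flow.comp (contMDiff_id.prodMk contMDiff_const)

theorem contMDiff_flow_right (s : ℝ) : ContMDiff IA IA ∞ (B.flow s) :=
  B.contMDiff_flow.comp (contMDiff_const.prodMk contMDiff_id)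

theorem flow_neg_flow (s : ℝ) (a : A) : B.flow (-s) (B.flow s a) = a := by
  rw [← B.flow_add, neg_add_cancel, B.flow_zero]

theorem flow_invariant_of_mvfderiv_generator {f : A → ℝ} (hf : ContMDiff IA 𝓘(ℝ, ℝ) ∞ f)
    (h : ∀ a, mvfderiv IA f a (B.generator a) = 0) (s : ℝ) (a : A) :
    f (B.flow s a) = f a := by
  have hd : ∀ a, HasDerivAt (fun s => f (B.flow s a)) 0 0 := by
    intro a
    have hc : ContMDiff 𝓘(ℝ, ℝ) 𝓘(ℝ, ℝ) ∞ (fun s => f (B.flow s a)) :=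
      hf.comp (B.contMDiff_flow_left a)
    have h1 := (hc.contDiff.differentiable (by simp) 0).hasDerivAt
    have h2 := mvfderiv_comp_apply_of_eq (g := f) (f := fun s => B.flow s a) (y := a) (0 : ℝ)
      (hf.mdifferentiable (by simp) a)
      ((B.contMDiff_flow_left a).mdifferentiable (by simp) 0) (B.flow_zero a) (1 : ℝ)
    have h3 : deriv (fun s => f (B.flow s a)) 0 = 0 := by
      rw [← fderiv_apply_one_eq_deriv, ← mfderiv_eq_fderiv]
      refine h2.trans ?_
      have := h a
      rw [generator] at this
      exact this
    rwa [h3] at h1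
  have hd' : ∀ s, HasDerivAt (fun s => f (B.flow s a)) 0 s := by
    intro s
    have h1 := hd (B.flow s a)
    simp only [← B.flow_add] at h1
    rw [← sub_self s] at h1
    simpa using h1.comp_sub_const s s
  have := is_const_of_deriv_eq_zero (fun s => (hd' s).differentiableAt) (fun s => (hd' s).deriv) s 0
  simpa [B.flow_zero] using this

end PrincipalRBundle

namespace SymplecticPrincipalRBundle

variable {EA : Type*} [NormedAddCommGroup EA] [NormedSpace ℝ EA]
  {HA : Type*} [TopologicalSpace HA] {IA : ModelWithCorners ℝ EA HA}
  {A : Type*} [TopologicalSpace A] [ChartedSpace HA A] [IsManifold IA ∞ A]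
  {EV : Type*} [NormedAddCommGroup EV] [NormedSpace ℝ EV]
  {HV : Type*} [TopologicalSpace HV] {IV : ModelWithCorners ℝ EV HV}
  {V : Type*} [TopologicalSpace V] [ChartedSpace HV V]
  (B : SymplecticPrincipalRBundle IA A IV V)

theorem contMDiff_pull (f : C^∞⟮IV, V; ℝ⟯) : ContMDiff IA 𝓘(ℝ, ℝ) ∞ fun a => f (B.proj a) :=
  f.contMDiff.comp B.contMDiff_proj

theorem ext_of_proj {f g : C^∞⟮IV, V; ℝ⟯} (h : ∀ a, f (B.proj a) = g (B.proj a)) : f = g :=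
  ContMDiffMap.ext fun v => by
    obtain ⟨a, rfl⟩ := B.proj_surjective v
    exact h a

variable {EG : Type*} [NormedAddCommGroup EG] [NormedSpace ℝ EG]
  {HG : Type*} [TopologicalSpace HG] {IG : ModelWithCorners ℝ EG HG}
  {G : Type*} [TopologicalSpace G] [ChartedSpace HG G] [Group G]
  {φ : SmoothAction IG G IA A}

theorem existsUnique_baseAction (hφ : B.IsCanonicalAction φ) :
    ∃! φV : SmoothAction IG G IV V, ∀ g a, φV.act g (B.proj a) = B.proj (φ.act g a) := by
  have hinv : ∀ g s a, B.proj (φ.act g (B.flow s a)) = B.proj (φ.act g a) := fun g s a => by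
    rw [hφ.commute, B.proj_flow]
  have hact : ∀ g a, B.descend (fun a => B.proj (φ.act g a)) (B.proj a) = B.proj (φ.act g a) :=
    fun g a => B.descend_proj (hinv g) a
  refine ⟨⟨fun g => B.descend fun a => B.proj (φ.act g a), ?_, ?_, ?_⟩, hact, ?_⟩
  · intro v
    obtain ⟨a, rfl⟩ := B.proj_surjective v
    rw [hact, φ.one_act]
  · intro g h v
    obtain ⟨a, rfl⟩ := B.proj_surjective v
    rw [hact, hact, hact, φ.mul_act]
  · refine B.contMDiff_of_comp_proj_snd ?_
    simp only [hact]
    exact B.contMDiff_proj.comp φ.contMDiff_act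
  · intro φ' h'
    have h : φ'.act = fun g => B.descend fun a => B.proj (φ.act g a) := by
      ext g v
      obtain ⟨a, rfl⟩ := B.proj_surjective v
      rw [h', hact]
    cases φ'
    simpa using h

variable [FiniteDimensional ℝ EA]

theorem bracket_pull_flow (f g : C^∞⟮IV, V; ℝ⟯) (s : ℝ) (a : A) :
    B.Ω.bracket (fun b => f (B.proj b)) (fun b => g (B.proj b)) (B.flow s a) =
      B.Ω.bracket (fun b => f (B.proj b)) (fun b => g (B.proj b)) a := by
  have h := B.Ω.bracket_comp (B.contMDiff_flow_right s) (B.contMDiff_flow_right (-s))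
    (fun x => by simpa using B.flow_neg_flow (-s) x) (B.flow_symplectic s) (B.contMDiff_pull f)
    (B.contMDiff_pull g) a (B.flow_neg_flow s a)
  simpa only [B.proj_flow] using h.symm

/-- The bracket on functions on the base induced by the bracket on the total space. -/
noncomputable def baseBracket (f g : C^∞⟮IV, V; ℝ⟯) : C^∞⟮IV, V; ℝ⟯ :=
  ⟨B.descend (B.Ω.bracket (fun b => f (B.proj b)) (fun b => g (B.proj b))),
    B.contMDiff_of_comp_proj (by
      simp only [B.descend_proj (B.bracket_pull_flow f g)]
      exact B.Ω.contMDiff_bracket (B.contMDiff_pull f) (B.contMDiff_pull g))⟩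

theorem baseBracket_proj (f g : C^∞⟮IV, V; ℝ⟯) (a : A) :
    B.baseBracket f g (B.proj a) =
      B.Ω.bracket (fun b => f (B.proj b)) (fun b => g (B.proj b)) a :=
  B.descend_proj (B.bracket_pull_flow f g) a

theorem baseBracket_swap (f g : C^∞⟮IV, V; ℝ⟯) : B.baseBracket f g = -B.baseBracket g f :=
  B.ext_of_proj fun a => by
    simp only [baseBracket_proj, ContMDiffMap.coe_neg, Pi.neg_apply]
    exact B.Ω.bracket_swap _ _ a

theorem baseBracket_add_left (f g h : C^∞⟮IV, V; ℝ⟯) :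
    B.baseBracket (f + g) h = B.baseBracket f h + B.baseBracket g h :=
  B.ext_of_proj fun a => by
    simp only [baseBracket_proj, ContMDiffMap.coe_add, Pi.add_apply]
    exact B.Ω.bracket_add_left ((B.contMDiff_pull f).mdifferentiable (by simp) a)
      ((B.contMDiff_pull g).mdifferentiable (by simp) a)

theorem baseBracket_smul_left (c : ℝ) (f h : C^∞⟮IV, V; ℝ⟯) :
    B.baseBracket (c • f) h = c • B.baseBracket f h :=
  B.ext_of_proj fun a => by
    simp only [baseBracket_proj, ContMDiffMap.coe_smul, Pi.smul_apply, smul_eq_mul]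
    exact B.Ω.bracket_const_mul_left ((B.contMDiff_pull f).mdifferentiable (by simp) a) c

/-- The Poisson structure on the base of a symplectic principal `ℝ`-bundle. -/
noncomputable def basePoisson [IA.Boundaryless] : PoissonStructure IV V where
  bracket := LinearMap.mk₂ ℝ B.baseBracket B.baseBracket_add_left B.baseBracket_smul_left
    (fun f g h => by
      rw [B.baseBracket_swap, B.baseBracket_add_left, B.baseBracket_swap f g,
        B.baseBracket_swap f h, neg_add])
    (fun c f g => by
      rw [B.baseBracket_swap, B.baseBracket_smul_left, B.baseBracket_swap f g, smul_neg])
  skew := B.baseBracket_swap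
  leibniz f g h := B.ext_of_proj fun a => by
    simp only [LinearMap.mk₂_apply, baseBracket_proj, ContMDiffMap.coe_add, ContMDiffMap.coe_mul,
      Pi.add_apply, Pi.mul_apply]
    exact B.Ω.bracket_mul_left ((B.contMDiff_pull f).mdifferentiable (by simp) a)
      ((B.contMDiff_pull g).mdifferentiable (by simp) a)
  jacobi f g h := B.ext_of_proj fun a => by
    simp only [LinearMap.mk₂_apply, baseBracket_proj, ContMDiffMap.coe_add, Pi.add_apply]
    exact B.Ω.bracket_jacobi (B.contMDiff_pull f) (B.contMDiff_pull g) (B.contMDiff_pull h) a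

theorem projIsPoisson_basePoisson [IA.Boundaryless] : B.ProjIsPoisson B.basePoisson :=
  fun f g a => (B.baseBracket_proj f g a).symm

variable {B} in
theorem ProjIsPoisson.eq {P Q : PoissonStructure IV V} (hP : B.ProjIsPoisson P)
    (hQ : B.ProjIsPoisson Q) : P = Q := by
  have h : P.bracket = Q.bracket := LinearMap.ext fun f => LinearMap.ext fun g =>
    B.ext_of_proj fun a => (hP f g a).symm.trans (hQ f g a)
  cases P
  cases Q
  simpa using h

theorem existsUnique_baseMomentum (hφ : B.IsCanonicalAction φ)
    {J : C^∞⟮IA, A; 𝓘(ℝ, LieDual IG G), LieDual IG G⟯} (hJ : B.Ω.IsMomentumMap φ J) :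
    ∃! JV : C^∞⟮IV, V; 𝓘(ℝ, LieDual IG G), LieDual IG G⟯, ∀ a, JV (B.proj a) = J a := by
  have hinv : ∀ s a, J (B.flow s a) = J a := by
    intro s a
    refine ContinuousLinearMap.ext fun ξ => ?_
    refine B.flow_invariant_of_mvfderiv_generator (f := momentComponent J ξ)
      (momentComponent J ξ).contMDiff (fun b => ?_) s a
    rw [← B.Ω.form_hamiltonian, ← hJ ξ b, B.Ω.form_swap, neg_eq_zero]
    exact hφ.basic ξ b
  refine ⟨⟨B.descend J, B.contMDiff_of_comp_proj ?_⟩, B.descend_proj hinv, fun J' hJ' => ?_⟩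
  · simp only [B.descend_proj hinv]
    exact J.contMDiff
  · refine ContMDiffMap.ext fun v => ?_
    obtain ⟨a, rfl⟩ := B.proj_surjective v
    exact (hJ' a).trans (B.descend_proj hinv a).symm

theorem isPoissonAction_base (hφ : B.IsCanonicalAction φ) {P : PoissonStructure IV V}
    {φV : SmoothAction IG G IV V} (hP : B.ProjIsPoisson P)
    (hφV : ∀ g a, φV.act g (B.proj a) = B.proj (φ.act g a)) : P.IsPoissonAction φV := by
  intro g f k
  refine B.ext_of_proj fun a => ?_
  have hm : ∀ g b, φV.map g (B.proj b) = B.proj (φ.act g b) := hφV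
  have hinv : ∀ g b, φ.act g⁻¹ (φ.act g b) = b := fun g b => by
    rw [← φ.mul_act, inv_mul_cancel, φ.one_act]
  rw [← hP, ContMDiffMap.comp_apply, hm, ← hP]
  simp only [ContMDiffMap.comp_apply, hm]
  exact B.Ω.bracket_comp (φ.map g).contMDiff (φ.map g⁻¹).contMDiff
    (fun x => by have h := hinv g⁻¹ x; rwa [inv_inv] at h) (hφ.symplectic g) (B.contMDiff_pull f)
    (B.contMDiff_pull k) a (hinv g a)

theorem isMomentumMap_base {J : C^∞⟮IA, A; 𝓘(ℝ, LieDual IG G), LieDual IG G⟯}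
    (hJ : B.Ω.IsMomentumMap φ J) {P : PoissonStructure IV V}
    {φV : SmoothAction IG G IV V} {JV : C^∞⟮IV, V; 𝓘(ℝ, LieDual IG G), LieDual IG G⟯}
    (hP : B.ProjIsPoisson P) (hφV : ∀ g a, φV.act g (B.proj a) = B.proj (φ.act g a))
    (hJV : ∀ a, JV (B.proj a) = J a) : P.IsMomentumMap φV JV := by
  intro ξ f v
  obtain ⟨a, rfl⟩ := B.proj_surjective v
  have hc : ContMDiff IG IA ∞ fun g => φ.act g a :=
    φ.contMDiff_act.comp (contMDiff_id.prodMk contMDiff_const)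
  have hgen : φV.generator ξ (B.proj a) = mfderiv IA IV B.proj a (φ.generator ξ a) := by
    have h := mfderiv_comp_apply_of_eq (I := IG) (I' := IA) (I'' := IV) (g := B.proj)
      (f := fun g => φ.act g a) (x := (1 : G)) (y := a) (B.contMDiff_proj.mdifferentiable (by simp) a)
      (hc.mdifferentiable (by simp) 1) (φ.one_act a) ξ
    have h' : B.proj ∘ (fun g => φ.act g a) = fun g => φV.act g (B.proj a) :=
      funext fun g => (hφV g a).symm
    rw [h'] at h
    exact h
  have hmom : (fun b => momentComponent JV ξ (B.proj b)) = momentComponent J ξ :=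
    funext fun b => congrArg (fun l : EG →L[ℝ] ℝ => l ξ) (hJV b)
  rw [← hP, hmom, ← B.Ω.mvfderiv_hamiltonian, ← hJ ξ a, hgen]
  exact (mvfderiv_comp_apply a (f.contMDiff.mdifferentiable (by simp) _)
    (B.contMDiff_proj.mdifferentiable (by simp) a) _).symm

end SymplecticPrincipalRBundle

theorem mainTheorem8
    {EA : Type*} [NormedAddCommGroup EA] [NormedSpace ℝ EA] [FiniteDimensional ℝ EA]
    {HA : Type*} [TopologicalSpace HA] {IA : ModelWithCorners ℝ EA HA} [IA.Boundaryless]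
    {A : Type*} [TopologicalSpace A] [ChartedSpace HA A] [IsManifold IA ∞ A]
    [T2Space A] [SecondCountableTopology A]
    {EV : Type*} [NormedAddCommGroup EV] [NormedSpace ℝ EV] [FiniteDimensional ℝ EV]
    {HV : Type*} [TopologicalSpace HV] {IV : ModelWithCorners ℝ EV HV} [IV.Boundaryless]
    {V : Type*} [TopologicalSpace V] [ChartedSpace HV V] [IsManifold IV ∞ V]
    [T2Space V] [SecondCountableTopology V]
    {EG : Type*} [NormedAddCommGroup EG] [NormedSpace ℝ EG] [FiniteDimensional ℝ EG]
    {HG : Type*} [TopologicalSpace HG] {IG : ModelWithCorners ℝ EG HG} [IG.Boundaryless]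
    {G : Type*} [TopologicalSpace G] [ChartedSpace HG G] [Group G] [LieGroup IG ∞ G]
    (B : SymplecticPrincipalRBundle IA A IV V)
    (φ : SmoothAction IG G IA A) (hφ : B.IsCanonicalAction φ)
    (J : C^∞⟮IA, A; 𝓘(ℝ, LieDual IG G), LieDual IG G⟯) (hJ : B.Ω.IsMomentumMap φ J) :
    (∃! P : PoissonStructure IV V, B.ProjIsPoisson P) ∧
    (∃! φV : SmoothAction IG G IV V, ∀ g a, φV.act g (B.proj a) = B.proj (φ.act g a)) ∧
    (∃! JV : C^∞⟮IV, V; 𝓘(ℝ, LieDual IG G), LieDual IG G⟯, ∀ a, JV (B.proj a) = J a) ∧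
    ∀ (P : PoissonStructure IV V) (φV : SmoothAction IG G IV V)
      (JV : C^∞⟮IV, V; 𝓘(ℝ, LieDual IG G), LieDual IG G⟯),
      B.ProjIsPoisson P →
      (∀ g a, φV.act g (B.proj a) = B.proj (φ.act g a)) →
      (∀ a, JV (B.proj a) = J a) →
      P.IsPoissonAction φV ∧ P.IsMomentumMap φV JV ∧
        (IsAdEquivariant φ J → IsAdEquivariant φV JV) := by
  refine ⟨⟨B.basePoisson, B.projIsPoisson_basePoisson,
    fun P hP => hP.eq B.projIsPoisson_basePoisson⟩, B.existsUnique_baseAction hφ,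
    B.existsUnique_baseMomentum hφ hJ, fun P φV JV hP hφV hJV => ⟨B.isPoissonAction_base hφ hP hφV,
    B.isMomentumMap_base hJ hP hφV hJV, fun hE g v ξ => ?_⟩⟩
  obtain ⟨a, rfl⟩ := B.proj_surjective v
  rw [hφV, hJV, hJV, hE]
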